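/- A represented space $\mathbf{Y}=(Y,\delta_{\mathbf Y})$ is a set $Y$ with a partial surjection $\delta_{\mathbf Y}:\subseteq\mathbb{N}^{\mathbb{N}}\to Y$; it carries the final topology of $\delta_{\mathbf Y}$, where $\operatorname{dom}(\delta_{\mathbf Y})\subseteq\mathbb{N}^{\mathbb{N}}$ has the subspace topology. It is admissibly represented if for every continuous partial function $\varphi:\subseteq\mathbb{N}^{\mathbb{N}}\to Y$ there is a continuous partial function $g:\subseteq\mathbb{N}^{\mathbb{N}}\to\mathbb{N}^{\mathbb{N}}$ with $\varphi(p)=\delta_{\mathbf Y}(g(p))$ for all $p\in\operatorname{dom}(\varphi)$. Let $\mathcal{O}(\mathbf Y)$ be the space of open subsets of $\mathbf Y$, represented as the space of continuous functions from $\mathbf Y$ to Sierpiński space, and let $\mathcal{V}(\mathbf Y)$ be the space of closed subsets $A$ of $\mathbf Y$, a name of $A$ being a name of $\{U\in\mathcal{O}(\mathbf Y) : U\cap A\neq\emptyset\}$ as an element of $\mathcal{O}(\mathcal{O}(\mathbf Y))$. Overt choice $\mathrm{VC}_{\mathbf Y}:\subseteq\mathcal{V}(\mathbf Y)\rightrightarrows\mathbf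 Y$ has as its domain the non-empty closed sets, and $x\in\mathrm{VC}_{\mathbf Y}(A)$ iff $x\in A$. Let $\mathrm{LPO}:\mathbb{N}^{\mathbb{N}}\to\{0,1\}$ be given by $\mathrm{LPO}(r)=1$ iff $r(k)=0$ for some $k$. A partial function $F:\subseteq\mathbb{N}^{\mathbb{N}}\to\mathbb{N}^{\mathbb{N}}$ realizes a multivalued function $f:\subseteq\mathbf X\rightrightarrows\mathbf Z$ if $\delta_{\mathbf Z}(F(p))\in f(\delta_{\mathbf X}(p))$ for all $p\in\operatorname{dom}(f\circ\delta_{\mathbf X})$. Write $f\le_{\mathrm W}^{\mathrm t}g$ (respectively $f\le_{\mathrm{sW}}^{\mathrm t}g$) if there are continuous partial functions $H,K:\subseteq\mathbb{N}^{\mathbb{N}}\to\mathbb{N}^{\mathbb{N}}$ such that $K\langle\mathrm{id},GH\rangle$ (respectively $KGH$) realizes $f$ whenever $G$ realizes $g$. **Theorem.** Let $\mathbf Y$ be an admissibly represented space whose topology is $T_1$ but not Fréchet–Urysohn (that is, the closure of some subset $M$ contains a point that is not the limit of any sequence in $M$). Then $\mathrm{LPO}\le_{\mathrm W}^{\mathrm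 t}\mathrm{VC}_{\mathbf Y}$, and even $\mathrm{LPO}\le_{\mathrm{sW}}^{\mathrm t}\mathrm{VC}_{\mathbf Y}$. -/

import Mathlib

noncomputable section

/-- Baire space, with the product topology of the discrete topologies. -/
abbrev Baire : Type := ℕ → ℕ

/-- A partial function is continuous if it is continuous on its domain, the domain carrying the
subspace topology. -/
def PartialContinuous {A B : Type*} [TopologicalSpace A] [TopologicalSpace B] (f : A →. B) : Prop :=
  Continuous f.asSubtype

/-- A represented space: a set together with a partial surjection from Baire space onto it.
`x ∈ X.rep p` says that `p` is a name of `x`. -/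
structure RepSpace where
  carrier : Type*
  rep : Baire →. carrier
  rep_surj : ∀ x : carrier, ∃ p : Baire, x ∈ rep p

namespace RepSpace

instance : CoeSort RepSpace (Type _) := ⟨RepSpace.carrier⟩

/-- The topology of a represented space: the final topology along the representation, whose
domain carries the subspace topology. -/
instance topology (X : RepSpace) : TopologicalSpace X.carrier :=
  TopologicalSpace.coinduced X.rep.asSubtype inferInstance

/-- A partial function with the given functional graph. -/
def ofGraph {A B : Type*} (R : A → B → Prop) : A →. B :=
  fun a => ⟨∃ b, R a b, fun h => h.choose⟩

theorem mem_ofGraph {A B : Type*} {R : A → B → Prop}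
    (hR : ∀ a b b', R a b → R a b' → b = b') (a : A) (b : B) : b ∈ ofGraph R a ↔ R a b := by
  constructor
  · rintro ⟨h, rfl⟩
    exact h.choose_spec
  · intro h
    exact ⟨⟨b, h⟩, hR _ _ _ (Exists.choose_spec (⟨b, h⟩ : ∃ b, R a b)) h⟩

/-- `F` is a realizer of the multivalued function `f : ⊆ X ⇉ Y`. A multivalued function is given by
its sets of values; its domain is the set of points with a nonempty set of values. -/
def Realizes {X Y : RepSpace} (F : Baire →. Baire) (f : X → Set Y) : Prop :=
  ∀ (p : Baire) (x : X), x ∈ X.rep p → (f x).Nonempty →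
    ∃ q ∈ F p, ∃ y ∈ Y.rep q, y ∈ f x

/-- The multivalued function of a single-valued total function. -/
def single {X Y : RepSpace} (f : X → Y) : X → Set Y := fun x => {f x}

/-- A function between represented spaces is continuous if it has a continuous realizer. -/
def RealizablyContinuous {X Y : RepSpace} (f : X → Y) : Prop :=
  ∃ F : Baire →. Baire, PartialContinuous F ∧ Realizes F (single f)

theorem realizes_single {X Y : RepSpace} {F : Baire →. Baire} {f : X → Y} :
    Realizes F (single f) ↔ ∀ (p : Baire) (x : X), x ∈ X.rep p → ∃ q ∈ F p, f x ∈ Y.rep q := by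
  unfold Realizes single
  simp only [Set.singleton_nonempty, true_imp_iff, Set.mem_singleton_iff]
  constructor
  · intro h p x hx
    obtain ⟨q, hq, y, hy, rfl⟩ := h p x hx
    exact ⟨q, hq, hy⟩
  · intro h p x hx
    obtain ⟨q, hq, hy⟩ := h p x hx
    exact ⟨q, hq, _, hy, rfl⟩

/-! ### The space of continuous functions -/

/-- The code of the number `n` together with the first `k` entries of `q`. -/
def code (n : ℕ) (q : Baire) (k : ℕ) : ℕ :=
  Encodable.encode ((n, (List.range k).map q) : ℕ × List ℕ)

open Classical in
/-- The continuous partial function on Baire space coded by `p` (application in Kleene's second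
algebra): to find the value at place `n`, query `p` on longer and longer prefixes of `q` until
an answer of the form `v + 1` is given. -/
def kleene (p : Baire) : Baire →. Baire := fun q =>
  ⟨∀ n, ∃ k, p (code n q k) ≠ 0, fun h n => p (code n q (Nat.find (h n))) - 1⟩

/-- Every continuous partial function on Baire space is extended by a coded one. -/
theorem exists_kleene (F : Baire →. Baire) (hF : PartialContinuous F) :
    ∃ p : Baire, ∀ q r, r ∈ F q → r ∈ kleene p q := by
  classical
  let P : ℕ → List ℕ → ℕ → Prop := fun n w v =>
    ∀ q r, r ∈ F q → (List.range w.length).map q = w → r n = v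
  let p : Baire := fun c => match (Encodable.decode c : Option (ℕ × List ℕ)) with
    | none => 0
    | some (n, w) => if h : ∃ v, P n w v then h.choose + 1 else 0
  have hp : ∀ n q k, p (code n q k) =
      if h : ∃ v, P n ((List.range k).map q) v then h.choose + 1 else 0 := by
    intro n q k
    simp only [p, code, Encodable.encodek]
  refine ⟨p, fun q r hr => ?_⟩
  have key : ∀ n, ∃ k, p (code n q k) ≠ 0 := by
    intro n
    obtain ⟨hd, hval⟩ := hr
    have hc : Continuous fun s : F.Dom => F.asSubtype s n :=
      (continuous_apply n).comp hF
    have ho : IsOpen {s : F.Dom | F.asSubtype s n = r n} :=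
      (isOpen_discrete {r n}).preimage hc
    obtain ⟨W, hW, hWeq⟩ := isOpen_induced_iff.1 ho
    have hqW : q ∈ W := by
      have : (⟨q, hd⟩ : F.Dom) ∈ Subtype.val ⁻¹' W := by
        rw [hWeq]
        change (F q).get hd n = r n
        rw [hval]
      exact this
    obtain ⟨_, ⟨x, k, rfl⟩, hqx, hsub⟩ :=
      (PiNat.isTopologicalBasis_cylinders (fun _ : ℕ => ℕ)).exists_subset_of_mem_open hqW hW
    refine ⟨k, ?_⟩
    have hex : ∃ v, P n ((List.range k).map q) v := by
      refine ⟨r n, fun q' r' hr' hpre => ?_⟩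
      have hq' : q' ∈ W := by
        apply hsub
        intro i hi
        have h1 : q' i = q i := by
          simp only [List.length_map, List.length_range] at hpre
          exact (List.map_inj_left.1 hpre) i (List.mem_range.2 hi)
        rw [h1]
        exact hqx i hi
      obtain ⟨hd', hval'⟩ := hr'
      have : (⟨q', hd'⟩ : F.Dom) ∈ Subtype.val ⁻¹' W := hq'
      rw [hWeq] at this
      have h2 : (F q').get hd' n = r n := this
      rw [← hval']
      exact h2
    rw [hp, dif_pos hex]
    exact Nat.succ_ne_zero _
  refine ⟨key, ?_⟩
  funext n
  change p (code n q (Nat.find (key n))) - 1 = r n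
  have hne := Nat.find_spec (key n)
  rw [hp] at hne ⊢
  split_ifs at hne ⊢ with h
  · rw [Nat.add_sub_cancel]
    exact (h.choose_spec q r hr (by simp)).symm
  · exact absurd rfl hne

/-- The represented space `C(X, Y)` of continuous functions: a name of `f` codes a realizer
of `f`. -/
def contFun (X Y : RepSpace) : RepSpace where
  carrier := {f : X → Y // RealizablyContinuous f}
  rep := ofGraph fun p f => Realizes (kleene p) (single f.1)
  rep_surj := by
    rintro ⟨f, F, hF, hr⟩
    obtain ⟨p, hp⟩ := exists_kleene F hF
    refine ⟨p, ?_⟩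
    rw [mem_ofGraph]
    · rw [realizes_single] at hr ⊢
      intro q x hx
      obtain ⟨r, hr1, hr2⟩ := hr q x hx
      exact ⟨r, hp _ _ hr1, hr2⟩
    · intro p f g hf hg
      rw [realizes_single] at hf hg
      apply Subtype.ext
      funext x
      obtain ⟨q, hq⟩ := X.rep_surj x
      obtain ⟨r, hr1, hr2⟩ := hf q x hq
      obtain ⟨s, hs1, hs2⟩ := hg q x hq
      obtain rfl := Part.mem_unique hr1 hs1
      exact Part.mem_unique hr2 hs2

theorem mem_rep_contFun {X Y : RepSpace} (p : Baire) (f : contFun X Y) :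
    f ∈ (contFun X Y).rep p ↔ Realizes (kleene p) (single f.1) := by
  refine mem_ofGraph (fun p f g hf hg => ?_) p f
  rw [realizes_single] at hf hg
  apply Subtype.ext
  funext x
  obtain ⟨q, hq⟩ := X.rep_surj x
  obtain ⟨r, hr1, hr2⟩ := hf q x hq
  obtain ⟨s, hs1, hs2⟩ := hg q x hq
  obtain rfl := Part.mem_unique hr1 hs1
  exact Part.mem_unique hr2 hs2

/-- Sierpiński space, with `⊤ = True` and `⊥ = False`; the only name of `⊥` is the zero sequence. -/
def sierpinski : RepSpace where
  carrier := Prop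
  rep := fun p => Part.some (p ≠ fun _ => 0)
  rep_surj := by
    intro x
    by_cases hx : x
    · refine ⟨fun _ => 1, ?_⟩
      simp only [Part.mem_some_iff, hx, eq_iff_iff, true_iff]
      intro h
      exact absurd (congrFun h 0) (by simp)
    · exact ⟨fun _ => 0, by simp [hx]⟩

/-- The represented space `O(X)` of open sets, a set being identified with its characteristic
function into Sierpiński space. -/
def opens (X : RepSpace) : RepSpace := contFun X sierpinski

/-- The characteristic function of a set, with values in Sierpiński space. -/
def charFun {X : RepSpace} (U : Set X) : X → sierpinski := fun x => (x ∈ U : Prop)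

/-- The characteristic functions of the members of `O(X)` are those of the sets that are open in
the topology of `X`. -/
theorem realizablyContinuous_sierpinski_iff {X : RepSpace} (U : Set X) :
    RealizablyContinuous (charFun U) ↔ IsOpen U := by
  classical
  constructor
  · rintro ⟨F, hF, hr⟩
    replace hr := realizes_single.1 hr
    change IsOpen (X.rep.asSubtype ⁻¹' U)
    rw [isOpen_iff_mem_nhds]
    rintro ⟨p, hp⟩ hpU
    have hdom : ∀ s : X.rep.Dom, (F s.1).Dom := by
      intro s
      obtain ⟨q, ⟨hq, _⟩, _⟩ := hr s.1 _ (Part.get_mem s.2)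
      exact hq
    have hval : ∀ s : X.rep.Dom, X.rep.asSubtype s ∈ U ↔
        F.asSubtype ⟨s.1, hdom s⟩ ≠ fun _ => 0 := by
      intro s
      obtain ⟨q, ⟨hq, hq'⟩, h⟩ := hr s.1 _ (Part.get_mem s.2)
      have h' := Part.mem_some_iff.1 h
      change (F s.1).get hq = q at hq'
      change X.rep.asSubtype s ∈ U ↔ (F s.1).get hq ≠ _
      rw [hq']
      exact Iff.of_eq h'
    have hc : Continuous fun s : X.rep.Dom => F.asSubtype ⟨s.1, hdom s⟩ :=
      hF.comp (Continuous.subtype_mk continuous_subtype_val _)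
    have ho : IsOpen {s : X.rep.Dom | F.asSubtype ⟨s.1, hdom s⟩ ≠ fun _ => 0} :=
      isOpen_ne.preimage hc
    have heq : X.rep.asSubtype ⁻¹' U =
        {s : X.rep.Dom | F.asSubtype ⟨s.1, hdom s⟩ ≠ fun _ => 0} := by
      ext s
      exact hval s
    rw [heq] at hpU ⊢
    exact ho.mem_nhds hpU
  · intro hU
    change IsOpen (X.rep.asSubtype ⁻¹' U) at hU
    obtain ⟨W, hW, hWeq⟩ := isOpen_induced_iff.1 hU
    let G : Baire → Baire := fun p n => if PiNat.cylinder p n ⊆ W then 1 else 0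
    have hG : Continuous G := by
      refine continuous_pi fun n => ?_
      rw [continuous_discrete_rng]
      intro b
      rw [isOpen_iff_mem_nhds]
      intro p hp
      refine Filter.mem_of_superset
        ((PiNat.isOpen_cylinder (fun _ : ℕ => ℕ) p n).mem_nhds (PiNat.self_mem_cylinder p n)) ?_
      intro q hq
      have : PiNat.cylinder q n = PiNat.cylinder p n := PiNat.mem_cylinder_iff_eq.1 hq
      simp only [Set.mem_preimage, Set.mem_singleton_iff, G] at hp ⊢
      rw [this]
      exact hp
    refine ⟨fun p => Part.some (G p), hG.comp continuous_subtype_val, realizes_single.2 ?_⟩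
    intro p x hx
    refine ⟨G p, Part.mem_some _, ?_⟩
    change (x ∈ U : Prop) ∈ Part.some (G p ≠ fun _ => 0)
    rw [Part.mem_some_iff, eq_iff_iff]
    obtain ⟨hd, rfl⟩ := hx
    have h1 : (X.rep p).get hd ∈ U ↔ p ∈ W := by
      have : (⟨p, hd⟩ : X.rep.Dom) ∈ Subtype.val ⁻¹' W ↔
        (⟨p, hd⟩ : X.rep.Dom) ∈ X.rep.asSubtype ⁻¹' U := by rw [hWeq]
      exact this.symm
    rw [h1]
    constructor
    · intro hpW hz
      obtain ⟨_, ⟨y, k, rfl⟩, hpx, hsub⟩ :=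
        (PiNat.isTopologicalBasis_cylinders (fun _ : ℕ => ℕ)).exists_subset_of_mem_open hpW hW
      rw [← PiNat.mem_cylinder_iff_eq.1 hpx] at hsub
      have h0 := congrFun hz k
      simp [G, hsub] at h0
    · intro hne
      by_contra hpW
      apply hne
      funext n
      have : ¬ PiNat.cylinder p n ⊆ W := fun h => hpW (h (PiNat.self_mem_cylinder p n))
      simp [G, this]

/-! ### Overt sets -/

/-- The family of open sets that intersect `A`. -/
def hitting {X : RepSpace} (A : Set X) : Set (opens X) := fun U => ∃ x ∈ A, U.1 x

theorem hitting_continuous {X : RepSpace} (A : Set X) :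
    RealizablyContinuous (charFun (hitting A)) := by
  classical
  rw [realizablyContinuous_sierpinski_iff]
  change IsOpen ((opens X).rep.asSubtype ⁻¹' hitting A)
  rw [isOpen_iff_mem_nhds]
  rintro ⟨p, hp⟩ ⟨x, hxA, hxU⟩
  obtain ⟨q, hq⟩ := X.rep_surj x
  have hreal : ∀ s : (opens X).rep.Dom, ∃ r ∈ kleene s.1 q,
      ((opens X).rep.asSubtype s).1 x ∈ sierpinski.rep r := by
    intro s
    have := (mem_rep_contFun s.1 ((opens X).rep.asSubtype s)).1 (Part.get_mem s.2)
    exact realizes_single.1 this q x hq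
  obtain ⟨r, ⟨hr, hr'⟩, hrx⟩ := hreal ⟨p, hp⟩
  have hrne : r ≠ fun _ => 0 := by
    rw [← Part.mem_some_iff.1 hrx]
    exact hxU
  obtain ⟨n, hn⟩ := Function.ne_iff.1 hrne
  have hO : IsOpen {p' : Baire | ∀ k ≤ Nat.find (hr n), p' (code n q k) = p (code n q k)} := by
    have : {p' : Baire | ∀ k ≤ Nat.find (hr n), p' (code n q k) = p (code n q k)} =
        ⋂ k ∈ Set.Iic (Nat.find (hr n)), {p' : Baire | p' (code n q k) = p (code n q k)} := by
      ext p'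
      simp
    rw [this]
    refine (Set.finite_Iic _).isOpen_biInter fun k _ => ?_
    exact (isOpen_discrete ({p (code n q k)} : Set ℕ)).preimage
      (continuous_apply (A := fun _ : ℕ => ℕ) (code n q k))
  refine Filter.mem_of_superset
    ((hO.preimage continuous_subtype_val).mem_nhds fun k _ => rfl) ?_
  intro s hs
  obtain ⟨t, ⟨ht, ht'⟩, htx⟩ := hreal s
  refine ⟨x, hxA, ?_⟩
  have htne : t ≠ fun _ => 0 := by
    apply Function.ne_iff.2
    refine ⟨n, ?_⟩
    have hfind : Nat.find (ht n) = Nat.find (hr n) := by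
      rw [Nat.find_eq_iff]
      refine ⟨?_, fun k hk => ?_⟩
      · rw [hs _ le_rfl]
        exact Nat.find_spec (hr n)
      · rw [hs _ hk.le]
        exact Nat.find_min (hr n) hk
    have e1 : t n = s.1 (code n q (Nat.find (ht n))) - 1 := by rw [← ht']; rfl
    have e2 : r n = p (code n q (Nat.find (hr n))) - 1 := by rw [← hr']; rfl
    rw [e1, hfind, hs _ le_rfl, ← e2]
    exact hn
  have := Part.mem_some_iff.1 htx
  rw [this]
  exact htne

/-- The family of open sets that intersect `A`, as a point of `O(O(X))`. -/
def hittingPoint {X : RepSpace} (A : Set X) : opens (opens X) :=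
  ⟨charFun (hitting A), hitting_continuous A⟩

theorem hittingPoint_injOn {X : RepSpace} {A B : Set X} (hA : IsClosed A) (hB : IsClosed B)
    (h : hittingPoint A = hittingPoint B) : A = B := by
  have key : ∀ {A B : Set X}, IsClosed B → hittingPoint A = hittingPoint B → A ⊆ B := by
    intro A B hB h x hx
    by_contra hxB
    let U : opens X := ⟨charFun Bᶜ, (realizablyContinuous_sierpinski_iff Bᶜ).2 hB.isOpen_compl⟩
    have h1 : (U ∈ hitting A) = (U ∈ hitting B) := congrFun (congrArg Subtype.val h) U
    have h2 : U ∈ hitting B := h1 ▸ (⟨x, hx, hxB⟩ : U ∈ hitting A)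
    obtain ⟨y, hy, hy'⟩ := h2
    exact hy' hy
  exact (key hB h).antisymm (key hA h.symm)

/-- The represented space `V(X)` of overt sets: its points are the closed subsets `A` of `X`, and
the names of `A` are the names of the family of open sets intersecting `A`, as a point of
`O(O(X))`. -/
def overt (X : RepSpace) : RepSpace where
  carrier := {A : Set X // IsClosed A}
  rep := ofGraph fun p A => hittingPoint A.1 ∈ (opens (opens X)).rep p
  rep_surj := by
    rintro A
    obtain ⟨p, hp⟩ := (opens (opens X)).rep_surj (hittingPoint A.1)
    refine ⟨p, (mem_ofGraph (fun p A B hA hB => ?_) p A).2 hp⟩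
    exact Subtype.ext (hittingPoint_injOn A.2 B.2 (Part.mem_unique hA hB))

theorem mem_rep_overt {X : RepSpace} (p : Baire) (A : overt X) :
    A ∈ (overt X).rep p ↔ hittingPoint A.1 ∈ (opens (opens X)).rep p :=
  mem_ofGraph (fun _ A B hA hB =>
    Subtype.ext (hittingPoint_injOn A.2 B.2 (Part.mem_unique hA hB))) p A

/-- Overt choice `VC_X : ⊆ V(X) ⇉ X`: find a point in a given nonempty overt set. -/
def overtChoice (X : RepSpace) : overt X → Set X := fun A => A.1

/-! ### LPO -/

/-- Baire space, represented by the identity. -/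
def baire : RepSpace where
  carrier := Baire
  rep := fun p => Part.some p
  rep_surj := fun x => ⟨x, Part.mem_some x⟩

/-- The discrete space `{0, 1}`; a name of `i` is a sequence starting with `i`. -/
def two : RepSpace where
  carrier := Fin 2
  rep := fun p => ⟨p 0 < 2, fun h => ⟨p 0, h⟩⟩
  rep_surj := fun i => ⟨fun _ => i, i.2, rfl⟩

open Classical in
/-- `LPO(r) = 1` if and only if `r k = 0` for some `k`. -/
def lpo : baire → two := fun r : Baire => (if ∃ k, r k = 0 then 1 else 0 : Fin 2)

/-! ### Admissibility and topological Weihrauch reducibility -/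

/-- Admissibility with respect to the topology of the represented space: every continuous partial
function from Baire space to `X` factors continuously through the representation (which is
itself continuous by the choice of the topology). -/
def Admissible (X : RepSpace) : Prop :=
  ∀ φ : Baire →. X, PartialContinuous φ →
    ∃ g : Baire →. Baire, PartialContinuous g ∧ ∀ p, ∀ x ∈ φ p, ∃ q ∈ g p, x ∈ X.rep q

/-- The pairing of Baire space, by interleaving. -/
def pair (p q : Baire) : Baire := fun n => if n % 2 = 0 then p (n / 2) else q (n / 2)

/-- Topological Weihrauch reducibility of `f` to `g`: some continuous `H`, `K` are such that
`K ⟨id, G H⟩` realizes `f` whenever `G` realizes `g`. -/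
def WeihrauchReducible {X Y U V : RepSpace} (f : X → Set Y) (g : U → Set V) : Prop :=
  ∃ H K : Baire →. Baire, PartialContinuous H ∧ PartialContinuous K ∧
    ∀ G : Baire →. Baire, Realizes G g →
      Realizes (K.comp fun p => ((G.comp H) p).map (pair p)) f

/-- Strong topological Weihrauch reducibility of `f` to `g`: some continuous `H`, `K` are such that
`K G H` realizes `f` whenever `G` realizes `g`. -/
def StrongWeihrauchReducible {X Y U V : RepSpace} (f : X → Set Y) (g : U → Set V) : Prop :=
  ∃ H K : Baire →. Baire, PartialContinuous H ∧ PartialContinuous K ∧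
    ∀ G : Baire →. Baire, Realizes G g → Realizes (K.comp (G.comp H)) f

end RepSpace

end

noncomputable section

namespace RepSpace

/-! Names live in a second countable metrizable space. This yields a sequence `m` and a point `x` in
the closure of its range such that no sequence of terms of `m` converges to `x`
(`exists_seq_mem_closure_range`). To an input `r` attach the set `{m 0, ..., m N}` if the first zero
of `r` is at `N`, and `{x}` if there is no zero; finite sets are closed by T1.

These sets have overt names depending continuously on `r` (`isOpen_hitting_zeroSet`,
`exists_continuous_overt_name`). A late zero cannot betray itself, because `x` is a limit of the `m
n` even uniformly over compact families of open sets (`isOpen_iInter_of_isCompact`).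

Conversely, a name of a chosen point reveals continuously whether that point is `x` or some `m n`,
since names of terms of `m` cannot converge to a name of `x` (`exists_continuous_separation`). That
answer is `LPO(r)`, and it is read off without consulting `r`, so the reduction is strong. -/

/-! ### Evaluation and continuous naming of open and overt sets -/

theorem code_congr {n k N : ℕ} {q q' : Baire} (h : q' ∈ PiNat.cylinder q N) (hk : k ≤ N) :
    code n q' k = code n q k := by
  unfold code
  congr 2
  refine List.map_congr_left fun i hi => ?_
  exact h i ((List.mem_range.1 hi).trans_le hk)

theorem mem_opens_rep_iff {X : RepSpace} (s : Baire) (U : opens X) :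
    U ∈ (opens X).rep s ↔
      ∀ (q : Baire) (x : X), x ∈ X.rep q → ∃ t ∈ kleene s q, (U.1 x ↔ t ≠ fun _ => 0) := by
  refine (mem_rep_contFun s U).trans (realizes_single.trans ?_)
  refine forall_congr' fun q => forall_congr' fun x => imp_congr_right fun _ =>
    exists_congr fun t => and_congr_right fun _ => ?_
  exact Part.mem_some_iff.trans eq_iff_iff

/-- Membership of a named point in a named open set is an open relation between names. -/
theorem isOpen_eval (X : RepSpace) :
    IsOpen {z : (opens X).rep.Dom × X.rep.Dom |
      ((opens X).rep.asSubtype z.1).1 (X.rep.asSubtype z.2)} := by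
  classical
  have hreal : ∀ z : (opens X).rep.Dom × X.rep.Dom, ∃ t ∈ kleene z.1.1 z.2.1,
      (((opens X).rep.asSubtype z.1).1 (X.rep.asSubtype z.2) ↔ t ≠ fun _ => 0) := fun z =>
    (mem_opens_rep_iff z.1.1 _).1 (Part.get_mem z.1.2) z.2.1 _ (Part.get_mem z.2.2)
  rw [isOpen_iff_mem_nhds]
  intro z hz
  obtain ⟨t, ⟨ht, rfl⟩, htx⟩ := hreal z
  obtain ⟨n, hn⟩ := Function.ne_iff.1 (htx.1 hz)
  -- Entry `n` of the output depends only on the first `N` entries of the point name and on the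
  -- answers to the queries of length at most `N`; freezing these finitely many data keeps the
  -- nonzero entry.
  let N := Nat.find (ht n)
  have hO : ∀ᶠ z' in nhds z, (∀ k ∈ Set.Iic N, z'.1.1 (code n z.2.1 k) = z.1.1 (code n z.2.1 k)) ∧
      z'.2.1 ∈ PiNat.cylinder z.2.1 N := by
    refine Filter.Eventually.and ?_ ?_
    · rw [Filter.eventually_all_finite (Set.finite_Iic N)]
      intro k _
      have hc : Continuous fun z' : (opens X).rep.Dom × X.rep.Dom => z'.1.1 (code n z.2.1 k) :=
        (continuous_apply _).comp (continuous_subtype_val.comp continuous_fst)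
      exact ((isOpen_discrete {z.1.1 (code n z.2.1 k)}).preimage hc).mem_nhds rfl
    · have hc : Continuous fun z' : (opens X).rep.Dom × X.rep.Dom => z'.2.1 :=
        continuous_subtype_val.comp continuous_snd
      exact ((PiNat.isOpen_cylinder (fun _ : ℕ => ℕ) z.2.1 N).preimage hc).mem_nhds
        (PiNat.self_mem_cylinder _ _)
  filter_upwards [hO] with z' ⟨h1, h2⟩
  obtain ⟨t', ⟨ht', rfl⟩, htx'⟩ := hreal z'
  have h3 : ∀ k ≤ N, z'.1.1 (code n z'.2.1 k) = z.1.1 (code n z.2.1 k) := fun k hk => by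
    rw [code_congr h2 hk, h1 k hk]
  refine htx'.2 (Function.ne_iff.2 ⟨n, ?_⟩)
  have hfind : Nat.find (ht' n) = N := by
    rw [Nat.find_eq_iff]
    refine ⟨?_, fun k hk => ?_⟩
    · rw [h3 _ le_rfl]
      exact Nat.find_spec (ht n)
    · rw [h3 _ hk.le]
      exact Nat.find_min (ht n) hk
  change z'.1.1 (code n z'.2.1 (Nat.find (ht' n))) - 1 ≠ 0
  rw [hfind, h3 _ le_rfl]
  exact hn

/-- The sections of an open relation on Baire space have codes that depend continuously on the
parameter. -/
theorem exists_continuous_code {W : Set (Baire × Baire)} (hW : IsOpen W) :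
    ∃ H : Baire → Baire, Continuous H ∧
      ∀ r s, ∃ t ∈ kleene (H r) s, ((r, s) ∈ W ↔ t ≠ fun _ => 0) := by
  classical
  let P : Baire → ℕ → List ℕ → Prop := fun r n w =>
    ∀ r' s' : Baire, r' ∈ PiNat.cylinder r n → (∀ i < n, s' i = w.getD i 0) → (r', s') ∈ W
  let H : Baire → Baire := fun r c => match (Encodable.decode c : Option (ℕ × List ℕ)) with
    | none => 0
    -- Answer `0` requests a longer prefix; `2` and `1` encode the outputs `1` and `0`. Waiting for
    -- length `n` means that the default value in `getD` is never read.
    | some (n, w) => if w.length < n then 0 else if P r n w then 2 else 1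
  have hH : ∀ r n s k, H r (code n s k) =
      if k < n then 0 else if PiNat.cylinder r n ×ˢ PiNat.cylinder s n ⊆ W then 2 else 1 := by
    intro r n s k
    simp only [H, code, Encodable.encodek, List.length_map, List.length_range]
    split_ifs with h1 h2 h3 h3
    · rfl
    · rfl
    · refine absurd ?_ h3
      rintro ⟨r', s'⟩ ⟨hr', hs'⟩
      refine h2 r' s' hr' fun i hi => ?_
      have hik : i < k := by omega
      simpa [List.getD, hik] using hs' i hi
    · refine absurd (fun r' s' hr' hs' => h3 (Set.mk_mem_prod hr' fun i hi => ?_) : P _ _ _) h2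
      have hik : i < k := by omega
      simpa [List.getD, hik] using hs' i hi
    · rfl
  refine ⟨H, continuous_pi fun c => ?_, fun r s => ?_⟩
  · obtain hc | ⟨⟨n, w⟩, hc⟩ := (Encodable.decode c : Option (ℕ × List ℕ)).eq_none_or_eq_some
    · simp only [H, hc]
      exact continuous_const
    · rw [continuous_discrete_rng]
      intro b
      rw [isOpen_iff_mem_nhds]
      intro r hr
      refine Filter.mem_of_superset
        ((PiNat.isOpen_cylinder (fun _ : ℕ => ℕ) r n).mem_nhds (PiNat.self_mem_cylinder r n)) ?_
      intro r' hr'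
      have : PiNat.cylinder r' n = PiNat.cylinder r n := PiNat.mem_cylinder_iff_eq.1 hr'
      simp only [Set.mem_preimage, Set.mem_singleton_iff, H, hc, P] at hr ⊢
      simpa only [this] using hr
  · have hdom : ∀ n, ∃ k, H r (code n s k) ≠ 0 := fun n =>
      ⟨n, by rw [hH, if_neg (lt_irrefl n)]; split_ifs <;> simp⟩
    refine ⟨_, ⟨hdom, rfl⟩, ?_⟩
    have hval : ∀ n, H r (code n s (Nat.find (hdom n))) - 1 =
        if PiNat.cylinder r n ×ˢ PiNat.cylinder s n ⊆ W then 1 else 0 := by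
      intro n
      have h0 := Nat.find_spec (hdom n)
      rw [hH] at h0 ⊢
      split_ifs at h0 ⊢ <;> simp_all
    change _ ↔ (fun n => H r (code n s (Nat.find (hdom n))) - 1) ≠ _
    simp only [hval]
    rw [Function.ne_iff]
    constructor
    · intro h
      obtain ⟨u, hu, v, hv, huv⟩ := mem_nhds_prod_iff.1 (hW.mem_nhds h)
      obtain ⟨_, ⟨a, k, rfl⟩, ha, hau⟩ :=
        (PiNat.isTopologicalBasis_cylinders (fun _ : ℕ => ℕ)).mem_nhds_iff.1 hu
      obtain ⟨_, ⟨b, l, rfl⟩, hb, hbv⟩ :=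
        (PiNat.isTopologicalBasis_cylinders (fun _ : ℕ => ℕ)).mem_nhds_iff.1 hv
      rw [← PiNat.mem_cylinder_iff_eq.1 ha] at hau
      rw [← PiNat.mem_cylinder_iff_eq.1 hb] at hbv
      refine ⟨max k l, ?_⟩
      rw [if_pos]
      · exact one_ne_zero
      · exact (Set.prod_mono
          ((PiNat.cylinder_anti r (le_max_left k l)).trans hau)
          ((PiNat.cylinder_anti s (le_max_right k l)).trans hbv)).trans huv
    · rintro ⟨n, hn⟩
      split_ifs at hn with h
      · exact h ⟨PiNat.self_mem_cylinder r n, PiNat.self_mem_cylinder s n⟩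
      · exact absurd rfl hn

/-- A family of closed sets for which being hit by a named open set is an open relation has
continuously chosen overt names. -/
theorem exists_continuous_overt_name {X : RepSpace} (A : Baire → overt X)
    (hA : IsOpen {z : Baire × (opens X).rep.Dom | (opens X).rep.asSubtype z.2 ∈ hitting (A z.1).1}) :
    ∃ H : Baire → Baire, Continuous H ∧ ∀ r, A r ∈ (overt X).rep (H r) := by
  -- The relation is open only relative to names, so it is first extended to an open subset of the
  -- full product; its values off the names are irrelevant.
  have hind : Topology.IsInducing
      (Prod.map id Subtype.val : Baire × (opens X).rep.Dom → Baire × Baire) :=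
    Topology.IsInducing.id.prodMap Topology.IsInducing.subtypeVal
  obtain ⟨W, hW, hWeq⟩ := hind.isOpen_iff.1 hA
  obtain ⟨H, hH, hHW⟩ := exists_continuous_code hW
  refine ⟨H, hH, fun r => (mem_rep_overt _ _).2 ((mem_opens_rep_iff _ _).2 fun s U hU => ?_)⟩
  obtain ⟨t, ht, htW⟩ := hHW r s
  refine ⟨t, ht, Iff.trans ?_ htW⟩
  obtain ⟨hd, rfl⟩ := hU
  exact (Set.ext_iff.1 hWeq (r, ⟨s, hd⟩)).symm

/-! ### Separability and compactness inherited from names -/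

theorem continuous_rep (X : RepSpace) : Continuous X.rep.asSubtype :=
  continuous_coinduced_rng

/-- In a represented space, every point of the closure of a set is in the closure of a sequence in
this set. -/
theorem exists_seq_mem_closure_range {X : RepSpace} {M : Set X} {x : X} (hx : x ∈ closure M) :
    ∃ m : ℕ → X, (∀ n, m n ∈ M) ∧ x ∈ closure (Set.range m) := by
  let S := X.rep.asSubtype ⁻¹' M
  have hsurj : ∀ y ∈ M, ∃ s : S, X.rep.asSubtype s.1 = y := by
    intro y hy
    obtain ⟨p, hp, rfl⟩ := X.rep_surj y
    exact ⟨⟨⟨p, hp⟩, hy⟩, rfl⟩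
  have hne : Nonempty S := by
    obtain ⟨y, hy⟩ := closure_nonempty_iff.1 ⟨x, hx⟩
    obtain ⟨s, _⟩ := hsurj y hy
    exact ⟨s⟩
  have hc : Continuous fun s : S => X.rep.asSubtype s.1 :=
    (continuous_rep X).comp continuous_subtype_val
  -- The names of points of `M` form a subspace of Baire space, hence a separable one; the image of
  -- a dense sequence is dense in `M`.
  refine ⟨fun n => X.rep.asSubtype (TopologicalSpace.denseSeq S n).1, fun n =>
    (TopologicalSpace.denseSeq S n).2, ?_⟩
  rw [mem_closure_iff] at hx ⊢
  intro U hU hxU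
  obtain ⟨y, hyU, hyM⟩ := hx U hU hxU
  obtain ⟨s, rfl⟩ := hsurj y hyM
  obtain ⟨n, hn⟩ := (TopologicalSpace.denseRange_denseSeq S).exists_mem_open
    (hU.preimage hc) ⟨s, hyU⟩
  exact ⟨_, hn, n, rfl⟩

/-- The intersection of the open sets with names in a compact set is open. -/
theorem isOpen_iInter_of_isCompact {X : RepSpace} {C : Set (opens X).rep.Dom} (hC : IsCompact C) :
    IsOpen {x : X | ∀ s ∈ C, ((opens X).rep.asSubtype s).1 x} := by
  change IsOpen (X.rep.asSubtype ⁻¹' _)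
  rw [isOpen_iff_mem_nhds]
  intro q hq
  refine hC.eventually_forall_of_forall_eventually fun s hs => ?_
  exact ((isOpen_eval X).preimage continuous_swap).mem_nhds (hq s hs)

/-! ### The closed sets attached to inputs of LPO -/

open Classical in
/-- The first `N + 1` terms of `m` if the first zero of `r` is at place `N`, and the point `x` if
`r` has no zero. -/
def zeroSet {X : Type*} (m : ℕ → X) (x : X) (r : Baire) : Set X :=
  if h : ∃ k, r k = 0 then m '' Set.Iic (Nat.find h) else {x}

theorem finite_zeroSet {X : Type*} (m : ℕ → X) (x : X) (r : Baire) : (zeroSet m x r).Finite := by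
  unfold zeroSet
  split_ifs
  · exact (Set.finite_Iic _).image m
  · exact Set.finite_singleton x

theorem zeroSet_nonempty {X : Type*} (m : ℕ → X) (x : X) (r : Baire) :
    (zeroSet m x r).Nonempty := by
  unfold zeroSet
  split_ifs
  · exact Set.nonempty_Iic.image m
  · exact Set.singleton_nonempty x

open Topology in
-- If `r` has a zero, nearby inputs have the same first zero and give the same set. Otherwise a
-- failure of openness gives a convergent sequence of counterexamples, whose open sets all contain
-- `x`; their intersection is open, so it contains some `m N`, which eventually lies in the attached
-- finite sets.
theorem isOpen_hitting_zeroSet {X : RepSpace} {m : ℕ → X} {x : X}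
    (hx : x ∈ closure (Set.range m)) :
    IsOpen {z : Baire × (opens X).rep.Dom |
      (opens X).rep.asSubtype z.2 ∈ hitting (zeroSet m x z.1)} := by
  classical
  have hev : ∀ y : X, IsOpen {s : (opens X).rep.Dom | ((opens X).rep.asSubtype s).1 y} := by
    intro y
    obtain ⟨q, hq, rfl⟩ := X.rep_surj y
    exact (isOpen_eval X).preimage (Continuous.prodMk_left (⟨q, hq⟩ : X.rep.Dom))
  rw [isOpen_iff_mem_nhds]
  rintro ⟨r, s⟩ ⟨y, hy, hys⟩
  change (opens X).rep.Dom at s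
  have hys' : ∀ᶠ z in 𝓝 (r, s), ((opens X).rep.asSubtype z.2).1 y :=
    ((hev y).preimage continuous_snd).mem_nhds hys
  have hcyl : ∀ N, ∀ᶠ z in 𝓝 (r, s), z.1 ∈ PiNat.cylinder r N := fun N =>
    ((PiNat.isOpen_cylinder (fun _ : ℕ => ℕ) r N).preimage continuous_fst).mem_nhds
      (PiNat.self_mem_cylinder _ _)
  by_cases h : ∃ k, r k = 0
  -- The `+ 1` makes the agreement include the zero itself.
  · filter_upwards [hys', hcyl (Nat.find h + 1)] with z hz1 hz2
    refine ⟨y, ?_, hz1⟩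
    have h0 : z.1 (Nat.find h) = 0 := (hz2 _ (Nat.lt_succ_self _)).trans (Nat.find_spec h)
    have hz : ∃ k, z.1 k = 0 := ⟨_, h0⟩
    have hfind : Nat.find hz = Nat.find h := by
      rw [Nat.find_eq_iff]
      refine ⟨h0, fun k hk => ?_⟩
      rw [hz2 k (by omega)]
      exact Nat.find_min h hk
    simp only [zeroSet, dif_pos h] at hy
    simp only [zeroSet, dif_pos hz, hfind]
    exact hy
  · simp only [zeroSet, dif_neg h, Set.mem_singleton_iff] at hy
    subst hy
    change ∀ᶠ z in 𝓝 (r, s), (opens X).rep.asSubtype z.2 ∈ hitting (zeroSet m y z.1)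
    by_contra hcon
    have hfreq : ∃ᶠ z in 𝓝 (r, s), ((opens X).rep.asSubtype z.2).1 y ∧
        (opens X).rep.asSubtype z.2 ∉ hitting (zeroSet m y z.1) :=
      ((Filter.not_eventually.1 hcon).and_eventually hys').mono fun _ h => h.symm
    obtain ⟨z, hz, hzP⟩ := Filter.exists_seq_forall_of_frequently hfreq
    have hz2 : Filter.Tendsto (fun n => (z n).2) Filter.atTop (𝓝 s) :=
      (continuous_snd.tendsto (r, s)).comp hz
    have hV := isOpen_iInter_of_isCompact hz2.isCompact_insert_range
    obtain ⟨_, hvV, N, rfl⟩ := mem_closure_iff.1 hx _ hV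
      (Set.forall_mem_insert.2 ⟨hys, Set.forall_mem_range.2 fun n => (hzP n).1⟩)
    -- Such an input has no zero before place `N`, so its set contains `m N` or is `{y}`; its open
    -- set contains both points.
    obtain ⟨n, hn⟩ := (hz.eventually (hcyl N)).exists
    refine (hzP n).2 ?_
    by_cases hzn : ∃ k, (z n).1 k = 0
    · refine ⟨m N, ?_, hvV _ (Or.inr ⟨n, rfl⟩)⟩
      simp only [zeroSet, dif_pos hzn]
      refine ⟨N, ?_, rfl⟩
      by_contra hlt
      rw [Set.mem_Iic, not_le] at hlt
      exact h ⟨_, (hn _ hlt).symm.trans (Nat.find_spec hzn)⟩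
    · refine ⟨y, ?_, (hzP n).1⟩
      simp only [zeroSet, dif_neg hzn]
      rfl

/-! ### Telling the limit point from the sequence -/

open Classical Topology in
/-- If no sequence in `range m` converges to `x`, then the names of `x` and the names of the terms
of `m` can be told apart continuously. -/
theorem exists_continuous_separation {X : RepSpace} [T1Space X.carrier] {m : ℕ → X} {x : X}
    (hx : ∀ u : ℕ → X, (∀ n, u n ∈ Set.range m) → ¬ Filter.Tendsto u Filter.atTop (𝓝 x)) :
    ∃ K : Baire →. Baire, PartialContinuous K ∧
      ∀ p, (x ∈ X.rep p → (fun _ => 0) ∈ K p) ∧ ∀ n, m n ∈ X.rep p → (fun _ => 1) ∈ K p := by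
  have hxm : ∀ n, m n ≠ x := fun n hn =>
    hx (fun _ => m n) (fun _ => ⟨n, rfl⟩) (hn ▸ tendsto_const_nhds)
  let K : Baire →. Baire := fun p =>
    ⟨∃ y ∈ X.rep p, y = x ∨ y ∈ Set.range m, fun _ => if x ∈ X.rep p then fun _ => 0 else fun _ => 1⟩
  have hdom : ∀ p : K.Dom, (X.rep p.1).Dom := by
    rintro ⟨p, y, ⟨hd, _⟩, _⟩
    exact hd
  let δ : K.Dom → X := fun p => X.rep.asSubtype ⟨p.1, hdom p⟩
  have hδ : Continuous δ :=
    (continuous_rep X).comp (continuous_subtype_val.subtype_mk _)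
  have hδx : ∀ p : K.Dom, x ∈ X.rep p.1 ↔ δ p = x := fun p =>
    ⟨fun h => Part.mem_unique (Part.get_mem (hdom p)) h, fun h => ⟨hdom p, h⟩⟩
  have hδm : ∀ p : K.Dom, δ p ≠ x → δ p ∈ Set.range m := by
    rintro ⟨p, y, hy, hyx⟩ hne
    have hyδ : y = δ ⟨p, y, hy, hyx⟩ := Part.mem_unique hy (Part.get_mem _)
    rw [← hyδ] at hne ⊢
    exact hyx.resolve_left hne
  -- Closedness is T1. For openness, names of terms of `m` tending to a name of `x` would give a
  -- sequence in `range m` converging to `x`.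
  have hclopen : IsClopen {p : K.Dom | δ p = x} := by
    refine ⟨isClosed_singleton.preimage hδ, ?_⟩
    rw [isOpen_iff_mem_nhds]
    intro p hp
    change ∀ᶠ p' in 𝓝 p, δ p' = x
    by_contra hcon
    obtain ⟨u, hu, huP⟩ := Filter.exists_seq_forall_of_frequently (Filter.not_eventually.1 hcon)
    refine hx (fun n => δ (u n)) (fun n => hδm _ (huP n)) ?_
    have := (hδ.tendsto p).comp hu
    rwa [show δ p = x from hp] at this
  refine ⟨K, ?_, fun p => ⟨fun h => ?_, fun n h => ?_⟩⟩
  · have : K.asSubtype = fun p => if δ p = x then fun _ => 0 else fun _ => 1 := by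
      funext p
      change (if x ∈ X.rep p.1 then _ else _) = _
      simp only [hδx]
    unfold PartialContinuous
    rw [this]
    exact continuous_const.if (fun p hp => by
      have := hclopen.frontier_eq
      rw [this] at hp
      exact hp.elim) continuous_const
  · exact ⟨⟨x, h, Or.inl rfl⟩, if_pos h⟩
  · exact ⟨⟨m n, h, Or.inr ⟨n, rfl⟩⟩, if_neg fun h' => hxm n (Part.mem_unique h h')⟩

/-! ### The reductions -/

theorem mem_comp {A B C : Type*} {f : B →. C} {g : A →. B} {a : A} {c : C} :
    c ∈ f.comp g a ↔ ∃ b ∈ g a, c ∈ f b := by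
  rw [PFun.comp_apply]
  exact Part.mem_bind_iff

/-- The second component of a pair. -/
def unpairSnd (p : Baire) : Baire := fun n => p (2 * n + 1)

theorem unpairSnd_pair (p q : Baire) : unpairSnd (pair p q) = q := by
  funext n
  have h1 : (2 * n + 1) % 2 ≠ 0 := by omega
  have h2 : (2 * n + 1) / 2 = n := by omega
  simp only [unpairSnd, pair, if_neg h1, h2]

theorem StrongWeihrauchReducible.weihrauchReducible {X Y U V : RepSpace} {f : X → Set Y}
    {g : U → Set V} (h : StrongWeihrauchReducible f g) : WeihrauchReducible f g := by
  obtain ⟨H, K, hH, hK, hG⟩ := h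
  have hc : Continuous unpairSnd := continuous_pi fun n => continuous_apply _
  refine ⟨H, fun p => K (unpairSnd p), hH, ?_, fun G hGg p x hx hne => ?_⟩
  · exact hK.comp ((hc.comp continuous_subtype_val).subtype_mk fun p => p.2)
  · obtain ⟨q, hq, hy⟩ := hG G hGg p x hx hne
    obtain ⟨a, ha, haq⟩ := mem_comp.1 hq
    refine ⟨q, mem_comp.2 ⟨pair p a, (Part.mem_map_iff _).2 ⟨a, ha, rfl⟩, ?_⟩, hy⟩
    rwa [unpairSnd_pair]

theorem strongWeihrauchReducible_lpo_overtChoice {X : RepSpace} [T1Space X.carrier]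
    (hFU : ¬ FrechetUrysohnSpace X) :
    StrongWeihrauchReducible (single lpo) (overtChoice X) := by
  classical
  obtain ⟨M, x, hxM, hxs⟩ : ∃ (M : Set X) (x : X), x ∈ closure M ∧ x ∉ seqClosure M := by
    by_contra! hcon
    exact hFU ⟨hcon⟩
  obtain ⟨m, hm, hxm⟩ := exists_seq_mem_closure_range hxM
  obtain ⟨K, hK, hKv⟩ := exists_continuous_separation (m := m) (x := x) fun u hu hux =>
    hxs ⟨u, fun n => by obtain ⟨k, hk⟩ := hu n; exact hk ▸ hm k, hux⟩
  obtain ⟨H, hH, hHA⟩ := exists_continuous_overt_name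
    (fun r => (⟨zeroSet m x r, (finite_zeroSet m x r).isClosed⟩ : overt X))
    (isOpen_hitting_zeroSet hxm)
  refine ⟨fun p => Part.some (H p), K, hH.comp continuous_subtype_val, hK, fun G hG => ?_⟩
  rw [realizes_single]
  intro p r hr
  obtain rfl : r = p := Part.mem_some_iff.1 hr
  obtain ⟨q, hq, y, hy, hyA⟩ := hG (H r) _ (hHA r) (zeroSet_nonempty m x r)
  change y ∈ zeroSet m x r at hyA
  have hqGH : q ∈ (G.comp fun p => Part.some (H p)) r :=
    mem_comp.2 ⟨H r, Part.mem_some _, hq⟩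
  by_cases h : ∃ k, r k = 0
  · simp only [zeroSet, dif_pos h] at hyA
    obtain ⟨n, _, rfl⟩ := hyA
    refine ⟨fun _ => 1, mem_comp.2 ⟨q, hqGH, (hKv q).2 n hy⟩, one_lt_two, ?_⟩
    exact (if_pos h).symm
  · simp only [zeroSet, dif_neg h, Set.mem_singleton_iff] at hyA
    subst hyA
    refine ⟨fun _ => 0, mem_comp.2 ⟨q, hqGH, (hKv q).1 hy⟩, two_pos, ?_⟩
    exact (if_neg h).symm

end RepSpace

end

theorem mainTheorem9 (Y : RepSpace) (hadm : Y.Admissible) (hT1 : T1Space Y)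
    (hFU : ¬ FrechetUrysohnSpace Y) :
    RepSpace.WeihrauchReducible (RepSpace.single RepSpace.lpo) (RepSpace.overtChoice Y) ∧
      RepSpace.StrongWeihrauchReducible (RepSpace.single RepSpace.lpo)
        (RepSpace.overtChoice Y) := by
  have h := RepSpace.strongWeihrauchReducible_lpo_overtChoice hFU
  exact ⟨h.weihrauchReducible, h⟩
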